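/- Let $G$ and $M$ be simplicial groups and $B$ a simplicial set, with $M$ and $B$ $1$-reduced. Let $\tau_1\colon B\to M$ be a twisting operator, $N=M\times_{\tau_1}B$ the twisted Cartesian product, and $\tau_0\colon N\to G$ a twisting operator. (A twisting operator $\tau\colon B\to G$ consists of maps $B_n\to G_{n-1}$ with $\partial_i\tau b=\tau\partial_i b$ for $i<n-1$, $\partial_{n-1}\tau b=\tau(\partial_n b)^{-1}\tau(\partial_{n-1}b)$, $\eta_i\tau b=\tau\eta_i b$ for $i\le n-1$, and $\tau(\eta_n b)=e_n$ for $b\in B_n$; in $G\times_\tau B$ faces and degeneracies are coordinatewise, except $\partial_n(g,b)=(\tau(b)\,\partial_n g,\partial_n b)$.) All chain complexes $C_*(-)$ are normalized, over $\mathbb Z$. A reduction $(f,g,h)\colon C\Rightarrow D$ consists of chain maps $f\colon C\to D$, $g\colon D\to C$ and a map $h\colon C_*\to C_{*+1}$ with $fg=\mathrm{id}$, $gf+dh+hd=\mathrm{id}$, $fh=0$, $hg=0$, $hh=0$. The tensor product of reductions is $(f\otimes f',\,g\otimes g',\,h\otimes \mathrm{id}+gf\otimes h')$, with the Koszul sign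 rule. A perturbation $\delta$ of the differential of $C$ induces, via the Basic Perturbation Lemma, the perturbation $f\delta\varphi g$ of the differential of $D$, where $\varphi=\sum_{i\ge0}(-1)^i(h\delta)^i$, and the triple $(f\psi,\varphi g,\varphi h)$, where $\psi=\sum_{i\ge0}(-1)^i(\delta h)^i$. By the Trivial Perturbation Lemma, a perturbation $\delta$ of the differential of $D$ yields a reduction with the same maps $f,g,h$ between $(C,d+g\delta f)$ and $(D,d+\delta)$. For a twisting operator $\tau$ let $C_*(G)\otimes_t C_*(B)$ be $C_*(G)\otimes C_*(B)$ with the perturbation induced, via the Basic Perturbation Lemma applied to the Eilenberg--Zilber reduction (Alexander--Whitney, Eilenberg--MacLane and Shih maps) $C_*(G\times B)\Rightarrow C_*(G)\otimes C_*(B)$, by $\delta(g,b)=(-1)^n[(\tau(b)\,\partial_n g,\partial_n b)-(\partial_n g,\partial_n b)]$, and let $\mathrm{TEZ}\colon C_*(G\times_\tau B)\Rightarrow C_*(G)\otimes_t C_*(B)$ be the resulting reduction. Let $\delta_1$ be the perturbation so obtained on $C_*(M)\otimes C_*(B)$ from $\tau_1$, and $\tilde\delta_0$ the one on $C_*(G)\otimes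 C_*(N)$ from $\tau_0$. Let $\tilde\delta_0'$ be the perturbation of $C_*(G)\otimes(C_*(M)\otimes_{t_1}C_*(B))$ induced by $\tilde\delta_0$ via the Basic Perturbation Lemma applied to $\mathrm{id}\otimes \mathrm{TEZ}_1$; adding it defines $C_*(G)\otimes_{t_0}(C_*(M)\otimes_{t_1}C_*(B))$. Let $\rho^{(0)}\colon \hat CG_*\Rightarrow C_*(G)$, $\rho^{(1)}\colon \hat CM_*\Rightarrow C_*(M)$, $\rho^{(2)}\colon \hat CB_*\Rightarrow C_*(B)$ be reductions of chain complexes of abelian groups, $\rho^{(i)}=(f^{(i)},g^{(i)},h^{(i)})$. The Trivial Perturbation Lemma applied to $\rho^{(1)}\otimes\rho^{(2)}$ and $\delta_1$ gives a reduction $r_1\colon \hat CM_*\otimes_{t_1}\hat CB_*\Rightarrow C_*(M)\otimes_{t_1}C_*(B)$, and applied to $\rho^{(0)}\otimes r_1$ and $\tilde\delta'_0$ it gives a reduction $$\rho_1'=(f,g,h)\colon \hat CG_*\otimes_{t_0}(\hat CM_*\otimes_{t_1}\hat CB_*)\Rightarrow C_*(G)\otimes_{t_0}(C_*(M)\otimes_{t_1}C_*(B)).$$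 For $P=(p_1,p_2)\in\mathbb Z^2$ let $p(P;2)\subseteq\mathbb Z^2$ be the downset of all $(x_1,x_2)$ with $(x_1+x_2,x_2)\le(p_1+p_2,p_2)$ in the lexicographic order. On each of the two complexes above, with underlying graded group $X\otimes(Y\otimes Z)$, let $F_{p(P;2)}$ in degree $n$ be $\bigoplus X_i\otimes(Y_j\otimes Z_k)$ over all $i+j+k=n$ with $(j,k)\in p(P;2)$. Then $f=f^{(0)}\otimes f^{(1)}\otimes f^{(2)}$ and $g=g^{(0)}\otimes g^{(1)}\otimes g^{(2)}$, and for all $P\in\mathbb Z^2$ the maps $f$ and $g$ send $F_{p(P;2)}$ into $F_{p(P;2)}$ (in each degree), while $$h(F_{p(P;2)})\subseteq F_{p(P+(0,1);2)}.$$ -/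

import Mathlib

open scoped TensorProduct

universe u v w u₁ v₁ w₁

noncomputable section

namespace SerreTower

/-! ### Simplicial sets, simplicial groups and twisted products -/

/-- A simplicial set, presented by its faces and degeneracies and the simplicial identities.
(This presentation is used because twisted products are defined through their faces and
degeneracies.) -/
structure SimplicialSet where
  X : ℕ → Type u
  face : ∀ {n : ℕ}, Fin (n + 2) → X (n + 1) → X n
  degen : ∀ {n : ℕ}, Fin (n + 1) → X n → X (n + 1)
  face_face : ∀ {n : ℕ} (i j : Fin (n + 2)) (x : X (n + 2)), i ≤ j →
    face i (face j.succ x) = face j (face i.castSucc x)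
  degen_degen : ∀ {n : ℕ} (i j : Fin (n + 1)) (x : X n), i ≤ j →
    degen i.castSucc (degen j x) = degen j.succ (degen i x)
  face_degen_lt : ∀ {n : ℕ} (i : Fin (n + 2)) (j : Fin (n + 1)) (x : X (n + 1)),
    i ≤ j.castSucc → face i.castSucc (degen j.succ x) = degen j (face i x)
  face_degen_self : ∀ {n : ℕ} (j : Fin (n + 1)) (x : X n), face j.castSucc (degen j x) = x
  face_degen_succ : ∀ {n : ℕ} (j : Fin (n + 1)) (x : X n), face j.succ (degen j x) = x
  face_degen_gt : ∀ {n : ℕ} (i : Fin (n + 2)) (j : Fin (n + 1)) (x : X (n + 1)),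
    j.castSucc < i → face i.succ (degen j.castSucc x) = degen j (face i x)

namespace SimplicialSet

/-- `x` is degenerate if `x = η_j y` for some simplex `y` of dimension one less. -/
def IsDegenerate (K : SimplicialSet.{u}) {n : ℕ} (x : K.X n) : Prop :=
  ∃ (m : ℕ) (j : Fin (m + 1)) (y : K.X m), (⟨n, x⟩ : Σ n, K.X n) = ⟨m + 1, K.degen j y⟩

/-- A unique `0`-simplex and no non-degenerate `1`-simplex. -/
def IsOneReduced (K : SimplicialSet.{u}) : Prop :=
  Nonempty (Unique (K.X 0)) ∧ ∀ x : K.X 1, K.IsDegenerate x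

/-- The (untwisted) Cartesian product. -/
def prod (X : SimplicialSet.{u}) (Y : SimplicialSet.{v}) : SimplicialSet.{max u v} where
  X n := X.X n × Y.X n
  face i p := (X.face i p.1, Y.face i p.2)
  degen i p := (X.degen i p.1, Y.degen i p.2)
  face_face i j x h := by simp [X.face_face i j _ h, Y.face_face i j _ h]
  degen_degen i j x h := by simp [X.degen_degen i j _ h, Y.degen_degen i j _ h]
  face_degen_lt i j x h := by simp [X.face_degen_lt i j _ h, Y.face_degen_lt i j _ h]
  face_degen_self j x := by simp [X.face_degen_self, Y.face_degen_self]
  face_degen_succ j x := by simp [X.face_degen_succ, Y.face_degen_succ]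
  face_degen_gt i j x h := by simp [X.face_degen_gt i j _ h, Y.face_degen_gt i j _ h]

end SimplicialSet

/-- A simplicial group: each `X n` is a group, and faces and degeneracies are homomorphisms. -/
structure SimplicialGroup extends SimplicialSet.{u} where
  [group : ∀ n, Group (X n)]
  face_mul : ∀ {n : ℕ} (i : Fin (n + 2)) (x y : X (n + 1)), face i (x * y) = face i x * face i y
  degen_mul : ∀ {n : ℕ} (i : Fin (n + 1)) (x y : X n), degen i (x * y) = degen i x * degen i y

attribute [instance] SimplicialGroup.group

/-- A twisting operator `τ : B → G` of degree `-1`. -/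
structure TwistingOperator (B : SimplicialSet.{u}) (G : SimplicialGroup.{v}) where
  toFun : ∀ {n : ℕ}, B.X (n + 1) → G.X n
  face_lt : ∀ {n : ℕ} (i : Fin (n + 1)) (b : B.X (n + 2)),
    G.face i.castSucc (toFun b) = toFun (B.face i.castSucc.castSucc b)
  face_last : ∀ {n : ℕ} (b : B.X (n + 2)),
    G.face (Fin.last (n + 1)) (toFun b) =
      (toFun (B.face (Fin.last (n + 2)) b))⁻¹ * toFun (B.face (Fin.last (n + 1)).castSucc b)
  degen_lt : ∀ {n : ℕ} (i : Fin (n + 1)) (b : B.X (n + 1)),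
    G.degen i (toFun b) = toFun (B.degen i.castSucc b)
  degen_last : ∀ {n : ℕ} (b : B.X n), toFun (B.degen (Fin.last n) b) = 1

/-- The twisted Cartesian product `G ×_τ B`. -/
def twistedProduct (G : SimplicialGroup.{v}) (B : SimplicialSet.{u}) (τ : TwistingOperator B G) :
    SimplicialSet.{max v u} where
  X n := G.X n × B.X n
  face {n} i p :=
    (if i = Fin.last (n + 1) then τ.toFun p.2 * G.face i p.1 else G.face i p.1, B.face i p.2)
  degen i p := (G.degen i p.1, B.degen i p.2)
  face_face {n} i j x h := by
    refine Prod.ext ?_ (B.face_face i j x.2 h)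
    induction j using Fin.lastCases with
    | last =>
      induction i using Fin.lastCases with
      | last =>
        have hne : (Fin.last (n + 1)).castSucc ≠ Fin.last (n + 1 + 1) :=
          (Fin.castSucc_lt_last _).ne
        simp only [Fin.succ_last, if_true, if_neg hne, G.face_mul, τ.face_last]
        rw [← Fin.succ_last (n + 1), G.face_face _ _ _ le_rfl]
        group
      | cast i =>
        have hne : i.castSucc ≠ Fin.last (n + 1) := (Fin.castSucc_lt_last _).ne
        have hne' : i.castSucc.castSucc ≠ Fin.last (n + 1 + 1) := (Fin.castSucc_lt_last _).ne
        simp only [Fin.succ_last, if_true, if_neg hne, if_neg hne', G.face_mul, τ.face_lt]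
        rw [← Fin.succ_last (n + 1), G.face_face _ _ _ h]
    | cast j =>
      have hi : i ≠ Fin.last (n + 1) := (h.trans_lt (Fin.castSucc_lt_last j)).ne
      have hi' : i.castSucc ≠ Fin.last (n + 1 + 1) := (Fin.castSucc_lt_last _).ne
      have hj : j.castSucc ≠ Fin.last (n + 1) := (Fin.castSucc_lt_last _).ne
      have hj' : j.castSucc.succ ≠ Fin.last (n + 1 + 1) := by
        rw [Fin.succ_castSucc]; exact (Fin.castSucc_lt_last _).ne
      simp only [if_neg hi, if_neg hi', if_neg hj, if_neg hj', G.face_face _ _ _ h]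
  degen_degen i j x h := by simp [G.degen_degen i j _ h, B.degen_degen i j _ h]
  face_degen_lt {n} i j x h := by
    refine Prod.ext ?_ (B.face_degen_lt i j x.2 h)
    have hi : i ≠ Fin.last (n + 1) := (h.trans_lt (Fin.castSucc_lt_last j)).ne
    have hi' : i.castSucc ≠ Fin.last (n + 1 + 1) := (Fin.castSucc_lt_last _).ne
    simp only [if_neg hi, if_neg hi', G.face_degen_lt _ _ _ h]
  face_degen_self {n} j x := by
    refine Prod.ext ?_ (B.face_degen_self j x.2)
    have hj : j.castSucc ≠ Fin.last (n + 1) := (Fin.castSucc_lt_last _).ne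
    simp only [if_neg hj, G.face_degen_self]
  face_degen_succ {n} j x := by
    refine Prod.ext ?_ (B.face_degen_succ j x.2)
    induction j using Fin.lastCases with
    | last => simp only [Fin.succ_last, if_true, τ.degen_last, one_mul]
              rw [← Fin.succ_last n, G.face_degen_succ]
    | cast j =>
      have hj : j.castSucc.succ ≠ Fin.last (_ + 1) := by
        rw [Fin.succ_castSucc]; exact (Fin.castSucc_lt_last _).ne
      simp only [if_neg hj, G.face_degen_succ]
  face_degen_gt {n} i j x h := by
    refine Prod.ext ?_ (B.face_degen_gt i j x.2 h)
    induction i using Fin.lastCases with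
    | last =>
      simp only [Fin.succ_last, if_true, ← τ.degen_lt, G.degen_mul]
      rw [← Fin.succ_last (n + 1), G.face_degen_gt _ _ _ h]
    | cast i =>
      have hi : i.castSucc ≠ Fin.last (n + 1) := (Fin.castSucc_lt_last _).ne
      have hi' : i.castSucc.succ ≠ Fin.last (n + 1 + 1) := by
        rw [Fin.succ_castSucc]; exact (Fin.castSucc_lt_last _).ne
      simp only [if_neg hi, if_neg hi', G.face_degen_gt _ _ _ h]

/-! ### Graded modules, complexes, reductions

Everything is set up over a commutative ring `R`; the case of interest is `R = ℤ`. -/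

/-- A `ℤ`-graded `R`-module, as a module that is the internal direct sum of the
submodules `gr i`. -/
structure GradedMod (R : Type) [CommRing R] where
  carrier : Type u
  [addCommGroup : AddCommGroup carrier]
  [module : Module R carrier]
  gr : ℤ → Submodule R carrier
  isInternal : DirectSum.IsInternal gr

attribute [instance] GradedMod.addCommGroup GradedMod.module

namespace GradedMod

variable {R : Type} [CommRing R]

/-- The linear map that is `φ i` on the component of degree `i`. -/
def piecewise (A : GradedMod.{u} R) {N : Type v} [AddCommGroup N] [Module R N]
    (φ : ℤ → A.carrier →ₗ[R] N) : A.carrier →ₗ[R] N :=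
  DirectSum.toModule R ℤ N (fun i => φ i ∘ₗ (A.gr i).subtype) ∘ₗ
    (LinearEquiv.ofBijective (DirectSum.coeLinearMap A.gr) A.isInternal).symm.toLinearMap

lemma piecewise_apply (A : GradedMod.{u} R) {N : Type v} [AddCommGroup N] [Module R N]
    (φ : ℤ → A.carrier →ₗ[R] N) {i : ℤ} {x : A.carrier} (hx : x ∈ A.gr i) :
    A.piecewise φ x = φ i x := by
  have : (LinearEquiv.ofBijective (DirectSum.coeLinearMap A.gr) A.isInternal).symm x
      = DirectSum.lof R ℤ (fun i => A.gr i) i ⟨x, hx⟩ := by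
    rw [LinearEquiv.symm_apply_eq]
    exact (DirectSum.coeLinearMap_lof A.gr i (⟨x, hx⟩ : A.gr i)).symm
  rw [piecewise, LinearMap.comp_apply, LinearEquiv.coe_coe, this, DirectSum.toModule_lof]
  rfl

lemma hom_ext (A : GradedMod.{u} R) {N : Type v} [AddCommGroup N] [Module R N]
    {φ ψ : A.carrier →ₗ[R] N} (h : ∀ i, ∀ x ∈ A.gr i, φ x = ψ x) : φ = ψ := by
  have : (⊤ : Submodule R A.carrier) ≤ LinearMap.eqLocus φ ψ := by
    rw [← A.isInternal.submodule_iSup_eq_top]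
    exact iSup_le fun i x hx => h i x hx
  ext x
  exact this (Submodule.mem_top (x := x))

/-- The sign operator `x ↦ (-1)^{|x|} x`. -/
def sign (A : GradedMod.{u} R) : A.carrier →ₗ[R] A.carrier :=
  A.piecewise fun i => ((i.negOnePow : ℤ) : R) • LinearMap.id

lemma sign_apply (A : GradedMod.{u} R) {i : ℤ} {x : A.carrier} (hx : x ∈ A.gr i) :
    A.sign x = ((i.negOnePow : ℤ) : R) • x := by
  simp [sign, A.piecewise_apply _ hx]

/-- A criterion for an internal direct sum: the pieces span, and each one is cut out by a
projection that kills the others. -/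
lemma isInternal_of_proj {A : Type u} [AddCommGroup A] [Module R A] (gr : ℤ → Submodule R A)
    (htop : ⨆ i, gr i = ⊤) (π : ℤ → A →ₗ[R] A) (h₁ : ∀ i, ∀ x ∈ gr i, π i x = x)
    (h₂ : ∀ i j, j ≠ i → ∀ x ∈ gr j, π i x = 0) : DirectSum.IsInternal gr := by
  refine DirectSum.isInternal_submodule_of_iSupIndep_of_iSup_eq_top ?_ htop
  rw [iSupIndep_def]
  intro i
  rw [Submodule.disjoint_def]
  intro x hx hx'
  have : ⨆ (j) (_ : j ≠ i), gr j ≤ LinearMap.ker (π i) :=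
    iSup₂_le fun j hj y hy => h₂ i j hj y hy
  rw [← h₁ i x hx]
  exact this hx'

/-- The projection onto the component of degree `n`. -/
def proj (A : GradedMod.{u} R) (n : ℤ) : A.carrier →ₗ[R] A.carrier :=
  A.piecewise fun i => if i = n then LinearMap.id else 0

/-- The degree `n` component of `A ⊗ B`: the sum of the `A_i ⊗ B_j` with `i + j = n`. -/
def tensorGr (A : GradedMod.{u} R) (B : GradedMod.{v} R) (n : ℤ) :
    Submodule R (A.carrier ⊗[R] B.carrier) :=
  Submodule.span R {t | ∃ (i j : ℤ) (a : A.carrier) (b : B.carrier),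
    i + j = n ∧ a ∈ A.gr i ∧ b ∈ B.gr j ∧ t = a ⊗ₜ[R] b}

lemma tmul_mem_tensorGr (A : GradedMod.{u} R) (B : GradedMod.{v} R) {i j n : ℤ}
    {a : A.carrier} {b : B.carrier} (ha : a ∈ A.gr i) (hb : b ∈ B.gr j) (h : i + j = n) :
    a ⊗ₜ[R] b ∈ tensorGr A B n :=
  Submodule.subset_span ⟨i, j, a, b, h, ha, hb, rfl⟩

lemma tensorGr_isInternal (A : GradedMod.{u} R) (B : GradedMod.{v} R) :
    DirectSum.IsInternal (tensorGr A B) := by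
  let π (n : ℤ) : A.carrier ⊗[R] B.carrier →ₗ[R] A.carrier ⊗[R] B.carrier :=
    TensorProduct.lift (A.piecewise fun i =>
      (TensorProduct.mk R A.carrier B.carrier).compl₂ (B.proj (n - i)))
  have hπ : ∀ (n i j : ℤ) (a : A.carrier) (b : B.carrier), a ∈ A.gr i → b ∈ B.gr j →
      π n (a ⊗ₜ[R] b) = if i + j = n then a ⊗ₜ[R] b else 0 := by
    intro n i j a b ha hb
    simp only [π, TensorProduct.lift.tmul, A.piecewise_apply _ ha, LinearMap.compl₂_apply,
      TensorProduct.mk_apply, proj, B.piecewise_apply _ hb]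
    by_cases h : i + j = n
    · rw [if_pos h, if_pos (by omega)]; rfl
    · rw [if_neg h, if_neg (by omega)]; simp
  refine isInternal_of_proj _ ?_ π ?_ ?_
  · rw [eq_top_iff, ← TensorProduct.span_tmul_eq_top, Submodule.span_le]
    rintro _ ⟨a, b, rfl⟩
    have ha : a ∈ ⨆ i, A.gr i := A.isInternal.submodule_iSup_eq_top ▸ Submodule.mem_top
    have hb : b ∈ ⨆ i, B.gr i := B.isInternal.submodule_iSup_eq_top ▸ Submodule.mem_top
    change a ⊗ₜ[R] b ∈ ⨆ i, tensorGr A B i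
    induction ha using Submodule.iSup_induction' with
    | mem i a ha =>
      induction hb using Submodule.iSup_induction' with
      | mem j b hb =>
        exact Submodule.mem_iSup_of_mem (i + j) (tmul_mem_tensorGr A B ha hb rfl)
      | zero => simp
      | add x y _ _ hx hy => rw [TensorProduct.tmul_add]; exact add_mem hx hy
    | zero => simp
    | add x y _ _ hx hy => rw [TensorProduct.add_tmul]; exact add_mem hx hy
  · intro n x hx
    induction hx using Submodule.span_induction with
    | mem x h => obtain ⟨i, j, a, b, hij, ha, hb, rfl⟩ := h; rw [hπ n i j a b ha hb, if_pos hij]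
    | zero => simp
    | add x y _ _ hx hy => rw [map_add, hx, hy]
    | smul r x _ hx => rw [map_smul, hx]
  · intro n m hm x hx
    induction hx using Submodule.span_induction with
    | mem x h =>
      obtain ⟨i, j, a, b, hij, ha, hb, rfl⟩ := h
      rw [hπ n i j a b ha hb, if_neg (by omega)]
    | zero => simp
    | add x y _ _ hx hy => rw [map_add, hx, hy, add_zero]
    | smul r x _ hx => rw [map_smul, hx, smul_zero]

/-- The tensor product, where `a ⊗ b` has degree `|a| + |b|`. -/
@[reducible]
def tensor (A : GradedMod.{u} R) (B : GradedMod.{v} R) : GradedMod.{max u v} R where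
  carrier := A.carrier ⊗[R] B.carrier
  gr := tensorGr A B
  isInternal := tensorGr_isInternal A B

/-- A linear map of degree `k`. -/
def HasDegree (A : GradedMod.{u} R) (B : GradedMod.{v} R)
    (φ : A.carrier →ₗ[R] B.carrier) (k : ℤ) : Prop :=
  ∀ i : ℤ, ∀ x ∈ A.gr i, φ x ∈ B.gr (i + k)

section

variable {A : GradedMod.{u} R} {B : GradedMod.{v} R} {C : GradedMod.{w} R}

lemma HasDegree.comp {φ : A.carrier →ₗ[R] B.carrier} {ψ : B.carrier →ₗ[R] C.carrier} {k l m : ℤ}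
    (hψ : HasDegree B C ψ l) (hφ : HasDegree A B φ k) (h : k + l = m) :
    HasDegree A C (ψ ∘ₗ φ) m := fun i x hx => by
  have := hψ _ _ (hφ i x hx)
  rwa [add_assoc, h] at this

lemma HasDegree.add {φ ψ : A.carrier →ₗ[R] B.carrier} {k : ℤ}
    (hφ : HasDegree A B φ k) (hψ : HasDegree A B ψ k) : HasDegree A B (φ + ψ) k :=
  fun i x hx => add_mem (hφ i x hx) (hψ i x hx)

lemma hasDegree_id : HasDegree A A LinearMap.id 0 := fun i x hx => by simpa using hx

lemma hasDegree_sign : HasDegree A A A.sign 0 := fun i x hx => by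
  rw [add_zero, A.sign_apply hx]
  exact Submodule.smul_mem _ _ hx

lemma HasDegree.map {A' : GradedMod.{u₁} R} {B' : GradedMod.{v₁} R}
    {φ : A.carrier →ₗ[R] B.carrier} {ψ : A'.carrier →ₗ[R] B'.carrier} {k l m : ℤ}
    (hφ : HasDegree A B φ k) (hψ : HasDegree A' B' ψ l) (h : k + l = m) :
    HasDegree (A.tensor A') (B.tensor B') (TensorProduct.map φ ψ) m := by
  intro n x hx
  change x ∈ tensorGr A A' n at hx
  change _ ∈ tensorGr B B' (n + m)
  induction hx using Submodule.span_induction with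
  | mem x hx =>
    obtain ⟨i, j, a, b, hij, ha, hb, rfl⟩ := hx
    exact tmul_mem_tensorGr B B' (hφ i a ha) (hψ j b hb) (by omega)
  | zero => rw [map_zero]; exact zero_mem _
  | add x y _ _ hx hy => rw [map_add]; exact add_mem hx hy
  | smul r x _ hx => rw [map_smul]; exact Submodule.smul_mem _ _ hx

/-- A map of odd degree anticommutes with the sign operators. -/
lemma HasDegree.sign_comp_odd {φ : A.carrier →ₗ[R] B.carrier} {k : ℤ}
    (hφ : HasDegree A B φ k) (hk : Odd k) : B.sign ∘ₗ φ = -(φ ∘ₗ A.sign) := by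
  refine A.hom_ext fun i x hx => ?_
  simp [B.sign_apply (hφ i x hx), A.sign_apply hx, Int.negOnePow_add, Int.negOnePow_odd k hk]

/-- A map of even degree commutes with the sign operators. -/
lemma HasDegree.sign_comp_even {φ : A.carrier →ₗ[R] B.carrier} {k : ℤ}
    (hφ : HasDegree A B φ k) (hk : Even k) : B.sign ∘ₗ φ = φ ∘ₗ A.sign := by
  refine A.hom_ext fun i x hx => ?_
  simp [B.sign_apply (hφ i x hx), A.sign_apply hx, Int.negOnePow_add, Int.negOnePow_even k hk]

lemma sign_comp_sign : A.sign ∘ₗ A.sign = LinearMap.id := by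
  refine A.hom_ext fun i x hx => ?_
  rw [LinearMap.comp_apply, A.sign_apply hx, map_smul, A.sign_apply hx, smul_smul,
    ← Int.cast_mul, ← Units.val_mul, Int.units_mul_self]
  simp

end

end GradedMod

open GradedMod

/-- A graded module with an endomorphism `d` of degree `-1`. It is a chain complex when
`d ∘ d = 0`, see `IsChainComplex`. -/
structure PreComplex (R : Type) [CommRing R] extends GradedMod.{u} R where
  d : carrier →ₗ[R] carrier
  d_deg : HasDegree toGradedMod toGradedMod d (-1)

section

variable {R : Type} [CommRing R]

namespace PreComplex

def IsChainComplex (C : PreComplex.{u} R) : Prop := C.d ∘ₗ C.d = 0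

/-- The tensor product, with `d (a ⊗ b) = d a ⊗ b + (-1)^{|a|} a ⊗ d b`. -/
@[reducible]
def tensor (C : PreComplex.{u} R) (D : PreComplex.{v} R) : PreComplex.{max u v} R where
  toGradedMod := C.toGradedMod.tensor D.toGradedMod
  d := TensorProduct.map C.d LinearMap.id + TensorProduct.map C.sign D.d
  d_deg := (C.d_deg.map hasDegree_id rfl).add (hasDegree_sign.map D.d_deg rfl)

/-- The object `(C, d + δ)` obtained from `C` by introducing the perturbation `δ`. -/
@[reducible]
def perturb (C : PreComplex.{u} R) (δ : C.carrier →ₗ[R] C.carrier)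
    (hδ : HasDegree C.toGradedMod C.toGradedMod δ (-1)) : PreComplex.{u} R where
  toGradedMod := C.toGradedMod
  d := C.d + δ
  d_deg := C.d_deg.add hδ

end PreComplex

/-- Maps `f : A → B`, `g : B → A` of degree `0` and `h : A → A` of degree `1`. -/
structure MapTriple (A : GradedMod.{u} R) (B : GradedMod.{v} R) where
  f : A.carrier →ₗ[R] B.carrier
  g : B.carrier →ₗ[R] A.carrier
  h : A.carrier →ₗ[R] A.carrier
  f_deg : HasDegree A B f 0
  g_deg : HasDegree B A g 0
  h_deg : HasDegree A A h 1

/-- A reduction `(f, g, h) : C ⇒ D`. -/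
structure Reduction (C : PreComplex.{u} R) (D : PreComplex.{v} R) extends
    MapTriple C.toGradedMod D.toGradedMod where
  f_chain : f ∘ₗ C.d = D.d ∘ₗ f
  g_chain : g ∘ₗ D.d = C.d ∘ₗ g
  f_g : f ∘ₗ g = LinearMap.id
  homotopy : g ∘ₗ f + C.d ∘ₗ h + h ∘ₗ C.d = LinearMap.id
  f_h : f ∘ₗ h = 0
  h_g : h ∘ₗ g = 0
  h_h : h ∘ₗ h = 0

/-- `u` is locally nilpotent: every element is killed by some power of `u`. -/
def LocallyNilpotent {A : Type u} [AddCommGroup A] [Module R A] (a : A →ₗ[R] A) : Prop :=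
  ∀ x : A, ∃ m : ℕ, (a ^ m) x = 0

lemma LocallyNilpotent.finite {A : Type u} [AddCommGroup A] [Module R A] {a : A →ₗ[R] A}
    (ha : LocallyNilpotent a) (x : A) :
    (Function.support fun i : ℕ => (-1 : R) ^ i • (a ^ i) x).Finite := by
  obtain ⟨m, hm⟩ := ha x
  refine (Set.finite_lt_nat m).subset fun i hi => ?_
  by_contra hlt
  obtain ⟨k, rfl⟩ := Nat.exists_eq_add_of_le (not_lt.mp hlt)
  refine hi ?_
  change (-1 : R) ^ (m + k) • (a ^ (m + k)) x = 0
  rw [add_comm m k, pow_add a, Module.End.mul_apply, hm, map_zero, smul_zero]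

open Classical in
/-- The locally finite sum `∑_{i ≥ 0} (-1)^i a^i` of a locally nilpotent endomorphism `a`
(and `0` if `a` is not locally nilpotent). -/
def alternatingSeries {A : Type u} [AddCommGroup A] [Module R A] (a : A →ₗ[R] A) : A →ₗ[R] A :=
  if ha : LocallyNilpotent a then
    { toFun := fun x => ∑ᶠ i : ℕ, (-1 : R) ^ i • (a ^ i) x
      map_add' := fun x y => by
        simp only [map_add, smul_add]
        exact finsum_add_distrib (ha.finite x) (ha.finite y)
      map_smul' := fun r x => by
        simp only [map_smul, RingHom.id_apply]
        rw [smul_finsum' r (ha.finite x)]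
        exact finsum_congr fun i => smul_comm _ _ _ }
  else 0

lemma hasDegree_alternatingSeries {A : GradedMod.{u} R} {a : A.carrier →ₗ[R] A.carrier}
    (ha : HasDegree A A a 0) : HasDegree A A (alternatingSeries a) 0 := by
  intro n x hx
  rw [add_zero]
  unfold alternatingSeries
  split_ifs with h
  · have : ∀ i : ℕ, (a ^ i) x ∈ A.gr n := by
      intro i
      induction i with
      | zero => simpa using hx
      | succ i ih =>
        rw [pow_succ', Module.End.mul_apply]
        simpa using ha n _ ih
    exact finsum_induction (· ∈ A.gr n) (zero_mem _) (fun _ _ => add_mem)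
      fun i => Submodule.smul_mem _ _ (this i)
  · simp

namespace MapTriple

/-- The triple `(id, id, 0)` of the trivial reduction. -/
def trivial (A : GradedMod.{u} R) : MapTriple A A where
  f := LinearMap.id
  g := LinearMap.id
  h := 0
  f_deg := hasDegree_id
  g_deg := hasDegree_id
  h_deg i x hx := by simp

/-- `f ⊗ f'`, `g ⊗ g'` and `h ⊗ id + (g f) ⊗ h'`, with the Koszul sign convention
`(φ ⊗ ψ) (a ⊗ b) = (-1)^{|ψ| |a|} φ a ⊗ ψ b`. -/
def tensor {A : GradedMod.{u} R} {B : GradedMod.{v} R} {A' : GradedMod.{u₁} R}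
    {B' : GradedMod.{v₁} R} (ρ : MapTriple A B) (ρ' : MapTriple A' B') :
    MapTriple (A.tensor A') (B.tensor B') where
  f := TensorProduct.map ρ.f ρ'.f
  g := TensorProduct.map ρ.g ρ'.g
  h := TensorProduct.map ρ.h LinearMap.id + TensorProduct.map ((ρ.g ∘ₗ ρ.f) ∘ₗ A.sign) ρ'.h
  f_deg := ρ.f_deg.map ρ'.f_deg rfl
  g_deg := ρ.g_deg.map ρ'.g_deg rfl
  h_deg := (ρ.h_deg.map hasDegree_id rfl).add
    (((ρ.g_deg.comp ρ.f_deg rfl).comp hasDegree_sign rfl).map ρ'.h_deg rfl)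

section BasicPerturbation

variable {A : GradedMod.{u} R} {B : GradedMod.{v} R} (ρ : MapTriple A B)
  (δ : A.carrier →ₗ[R] A.carrier)

/-- `φ = ∑ (-1)^i (h δ)^i`. -/
def bplPhi : A.carrier →ₗ[R] A.carrier := alternatingSeries (ρ.h ∘ₗ δ)

/-- `ψ = ∑ (-1)^i (δ h)^i`. -/
def bplPsi : A.carrier →ₗ[R] A.carrier := alternatingSeries (δ ∘ₗ ρ.h)

/-- The perturbation `f δ φ g` induced on `B` by the perturbation `δ` of `A`, in the Basic
Perturbation Lemma. -/
def inducedPerturbation : B.carrier →ₗ[R] B.carrier := ρ.f ∘ₗ δ ∘ₗ ρ.bplPhi δ ∘ₗ ρ.g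

lemma hasDegree_bplPhi (hδ : HasDegree A A δ (-1)) : HasDegree A A (ρ.bplPhi δ) 0 :=
  hasDegree_alternatingSeries (ρ.h_deg.comp hδ rfl)

lemma hasDegree_bplPsi (hδ : HasDegree A A δ (-1)) : HasDegree A A (ρ.bplPsi δ) 0 :=
  hasDegree_alternatingSeries (hδ.comp ρ.h_deg rfl)

lemma hasDegree_inducedPerturbation (hδ : HasDegree A A δ (-1)) :
    HasDegree B B (ρ.inducedPerturbation δ) (-1) :=
  ρ.f_deg.comp (hδ.comp ((ρ.hasDegree_bplPhi δ hδ).comp ρ.g_deg rfl) rfl) rfl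

/-- The triple `(f ψ, φ g, φ h)` of the Basic Perturbation Lemma. -/
def basicPerturbation (hδ : HasDegree A A δ (-1)) : MapTriple A B where
  f := ρ.f ∘ₗ ρ.bplPsi δ
  g := ρ.bplPhi δ ∘ₗ ρ.g
  h := ρ.bplPhi δ ∘ₗ ρ.h
  f_deg := ρ.f_deg.comp (ρ.hasDegree_bplPsi δ hδ) rfl
  g_deg := (ρ.hasDegree_bplPhi δ hδ).comp ρ.g_deg rfl
  h_deg := (ρ.hasDegree_bplPhi δ hδ).comp ρ.h_deg rfl

end BasicPerturbation

end MapTriple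

lemma map_neg_left {A : Type u} {B : Type v} {A' : Type w} {B' : Type u₁} [AddCommGroup A]
    [AddCommGroup B] [AddCommGroup A'] [AddCommGroup B'] [Module R A] [Module R B] [Module R A']
    [Module R B'] (φ : A →ₗ[R] B) (ψ : A' →ₗ[R] B') :
    TensorProduct.map (-φ) ψ = -TensorProduct.map φ ψ :=
  TensorProduct.ext' fun a b => by simp [TensorProduct.neg_tmul]

lemma map_neg_right {A : Type u} {B : Type v} {A' : Type w} {B' : Type u₁} [AddCommGroup A]
    [AddCommGroup B] [AddCommGroup A'] [AddCommGroup B'] [Module R A] [Module R B] [Module R A']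
    [Module R B'] (φ : A →ₗ[R] B) (ψ : A' →ₗ[R] B') :
    TensorProduct.map φ (-ψ) = -TensorProduct.map φ ψ :=
  TensorProduct.ext' fun a b => by simp [TensorProduct.tmul_neg]

namespace Reduction

/-- The tensor product of two reductions. -/
def tensor {C : PreComplex.{u} R} {D : PreComplex.{v} R} {C' : PreComplex.{u₁} R}
    {D' : PreComplex.{v₁} R} (ρ : Reduction C D) (ρ' : Reduction C' D') :
    Reduction (C.tensor C') (D.tensor D') where
  toMapTriple := ρ.toMapTriple.tensor ρ'.toMapTriple
  f_chain := by
    simp only [MapTriple.tensor, LinearMap.comp_add, LinearMap.add_comp, ← TensorProduct.map_comp,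
      ρ.f_chain, ρ'.f_chain, LinearMap.id_comp, LinearMap.comp_id,
      ρ.f_deg.sign_comp_even Even.zero]
  g_chain := by
    simp only [MapTriple.tensor, LinearMap.comp_add, LinearMap.add_comp, ← TensorProduct.map_comp,
      ρ.g_chain, ρ'.g_chain, LinearMap.id_comp, LinearMap.comp_id,
      ρ.g_deg.sign_comp_even Even.zero]
  f_g := by
    simp only [MapTriple.tensor, ← TensorProduct.map_comp, ρ.f_g, ρ'.f_g, TensorProduct.map_id]
  homotopy := by
    have hsh : C.sign ∘ₗ ρ.h = -(ρ.h ∘ₗ C.sign) := ρ.h_deg.sign_comp_odd odd_one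
    have hsd : C.sign ∘ₗ C.d = -(C.d ∘ₗ C.sign) := C.d_deg.sign_comp_odd (by decide)
    have hgf : HasDegree C.toGradedMod C.toGradedMod (ρ.g ∘ₗ ρ.f) 0 := ρ.g_deg.comp ρ.f_deg rfl
    have hss : C.sign ∘ₗ (ρ.g ∘ₗ ρ.f) ∘ₗ C.sign = ρ.g ∘ₗ ρ.f := by
      rw [← LinearMap.comp_assoc, hgf.sign_comp_even Even.zero, LinearMap.comp_assoc,
        sign_comp_sign, LinearMap.comp_id]
    have hss' : ((ρ.g ∘ₗ ρ.f) ∘ₗ C.sign) ∘ₗ C.sign = ρ.g ∘ₗ ρ.f := by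
      rw [LinearMap.comp_assoc, sign_comp_sign, LinearMap.comp_id]
    have hc : (ρ.g ∘ₗ ρ.f) ∘ₗ C.d = C.d ∘ₗ (ρ.g ∘ₗ ρ.f) := by
      rw [LinearMap.comp_assoc, ρ.f_chain, ← LinearMap.comp_assoc, ρ.g_chain, LinearMap.comp_assoc]
    have hsd' : ((ρ.g ∘ₗ ρ.f) ∘ₗ C.sign) ∘ₗ C.d = -(C.d ∘ₗ (ρ.g ∘ₗ ρ.f) ∘ₗ C.sign) := by
      rw [LinearMap.comp_assoc, hsd, LinearMap.comp_neg, ← LinearMap.comp_assoc, hc,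
        LinearMap.comp_assoc]
    have h₁ : C.d ∘ₗ ρ.h + ρ.h ∘ₗ C.d = LinearMap.id - ρ.g ∘ₗ ρ.f := by
      rw [← ρ.homotopy]; abel
    have h₂ : C'.d ∘ₗ ρ'.h + ρ'.h ∘ₗ C'.d = LinearMap.id - ρ'.g ∘ₗ ρ'.f := by
      rw [← ρ'.homotopy]; abel
    have e₁ : TensorProduct.map (C.d ∘ₗ ρ.h) LinearMap.id
        + TensorProduct.map (ρ.h ∘ₗ C.d) LinearMap.id
        = TensorProduct.map LinearMap.id (LinearMap.id : C'.carrier →ₗ[R] C'.carrier)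
          - TensorProduct.map (ρ.g ∘ₗ ρ.f) LinearMap.id := by
      rw [← TensorProduct.map_add_left, h₁, sub_eq_add_neg, TensorProduct.map_add_left,
        map_neg_left, ← sub_eq_add_neg]
    have e₂ : TensorProduct.map (ρ.g ∘ₗ ρ.f) (C'.d ∘ₗ ρ'.h)
        + TensorProduct.map (ρ.g ∘ₗ ρ.f) (ρ'.h ∘ₗ C'.d)
        = TensorProduct.map (ρ.g ∘ₗ ρ.f) LinearMap.id
          - TensorProduct.map (ρ.g ∘ₗ ρ.f) (ρ'.g ∘ₗ ρ'.f) := by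
      rw [← TensorProduct.map_add_right, h₂, sub_eq_add_neg, TensorProduct.map_add_right,
        map_neg_right, ← sub_eq_add_neg]
    simp only [MapTriple.tensor, LinearMap.comp_add, LinearMap.add_comp, ← TensorProduct.map_comp,
      LinearMap.id_comp, LinearMap.comp_id, hsh, hss, hss', hsd', map_neg_left]
    rw [← TensorProduct.map_id]
    have e := congrArg₂ (· + ·) (sub_eq_zero.2 e₁) (sub_eq_zero.2 e₂)
    rw [add_zero] at e
    rw [← sub_eq_zero]
    refine Eq.trans ?_ e
    abel
  f_h := by
    simp only [MapTriple.tensor, LinearMap.comp_add, ← TensorProduct.map_comp, ρ.f_h, ρ'.f_h,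
      TensorProduct.map_zero_left, TensorProduct.map_zero_right, add_zero]
  h_g := by
    simp only [MapTriple.tensor, LinearMap.add_comp, ← TensorProduct.map_comp, ρ.h_g, ρ'.h_g,
      TensorProduct.map_zero_left, TensorProduct.map_zero_right, add_zero]
  h_h := by
    have hsh : C.sign ∘ₗ ρ.h = -(ρ.h ∘ₗ C.sign) := ρ.h_deg.sign_comp_odd odd_one
    have h₁ : ((ρ.g ∘ₗ ρ.f) ∘ₗ C.sign) ∘ₗ ρ.h = 0 := by
      rw [LinearMap.comp_assoc, hsh, LinearMap.comp_neg, ← LinearMap.comp_assoc,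
        LinearMap.comp_assoc ρ.h, ρ.f_h]
      simp
    have h₂ : ρ.h ∘ₗ (ρ.g ∘ₗ ρ.f) ∘ₗ C.sign = 0 := by
      rw [← LinearMap.comp_assoc, ← LinearMap.comp_assoc, ρ.h_g]
      simp
    simp only [MapTriple.tensor, LinearMap.add_comp, LinearMap.comp_add, ← TensorProduct.map_comp,
      ρ.h_h, ρ'.h_h, h₁, h₂, TensorProduct.map_zero_left, TensorProduct.map_zero_right, add_zero]

section TrivialPerturbation

variable {C : PreComplex.{u} R} {D : PreComplex.{v} R} (ρ : Reduction C D)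
  (δ : D.carrier →ₗ[R] D.carrier)

lemma hasDegree_pullback (hδ : HasDegree D.toGradedMod D.toGradedMod δ (-1)) :
    HasDegree C.toGradedMod C.toGradedMod (ρ.g ∘ₗ δ ∘ₗ ρ.f) (-1) :=
  ρ.g_deg.comp (hδ.comp ρ.f_deg rfl) rfl

/-- The Trivial Perturbation Lemma: the perturbation `δ` of `D` and the perturbation `g δ f` of
`C`, with the same maps `f`, `g`, `h`. -/
def trivialPerturbation (hδ : HasDegree D.toGradedMod D.toGradedMod δ (-1)) :
    Reduction (C.perturb (ρ.g ∘ₗ δ ∘ₗ ρ.f) (ρ.hasDegree_pullback δ hδ)) (D.perturb δ hδ) where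
  toMapTriple := ρ.toMapTriple
  f_chain := by
    have h₁ : ρ.f ∘ₗ (ρ.g ∘ₗ δ ∘ₗ ρ.f) = δ ∘ₗ ρ.f := by
      rw [← LinearMap.comp_assoc, ρ.f_g, LinearMap.id_comp]
    change ρ.f ∘ₗ (C.d + ρ.g ∘ₗ δ ∘ₗ ρ.f) = (D.d + δ) ∘ₗ ρ.f
    rw [LinearMap.comp_add, LinearMap.add_comp, ρ.f_chain, h₁]
  g_chain := by
    have h₁ : (ρ.g ∘ₗ δ ∘ₗ ρ.f) ∘ₗ ρ.g = ρ.g ∘ₗ δ := by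
      rw [LinearMap.comp_assoc, LinearMap.comp_assoc, ρ.f_g, LinearMap.comp_id]
    change ρ.g ∘ₗ (D.d + δ) = (C.d + ρ.g ∘ₗ δ ∘ₗ ρ.f) ∘ₗ ρ.g
    rw [LinearMap.comp_add, LinearMap.add_comp, ρ.g_chain, h₁]
  f_g := ρ.f_g
  homotopy := by
    have h₁ : (ρ.g ∘ₗ δ ∘ₗ ρ.f) ∘ₗ ρ.h = 0 := by
      rw [LinearMap.comp_assoc, LinearMap.comp_assoc, ρ.f_h, LinearMap.comp_zero,
        LinearMap.comp_zero]
    have h₂ : ρ.h ∘ₗ (ρ.g ∘ₗ δ ∘ₗ ρ.f) = 0 := by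
      rw [← LinearMap.comp_assoc, ρ.h_g, LinearMap.zero_comp]
    rw [LinearMap.add_comp, LinearMap.comp_add, h₁, h₂, add_zero, add_zero, ρ.homotopy]
  f_h := ρ.f_h
  h_g := ρ.h_g
  h_h := ρ.h_h

end TrivialPerturbation

end Reduction

/-! ### Normalized chains -/

namespace SimplicialSet

/-- The simplices of `K`, of all dimensions. -/
abbrev Simplex (K : SimplicialSet.{u}) : Type u := Σ n, K.X n

/-- The non-degenerate simplices of `K`, of all dimensions. -/
abbrev NonDegenerate (K : SimplicialSet.{u}) : Type u := Σ n, {x : K.X n // ¬ K.IsDegenerate x}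

variable (R)

open Classical in
/-- The class of a simplex in the normalized chains: degenerate simplices are `0`. -/
def cls (K : SimplicialSet.{u}) {n : ℕ} (x : K.X n) : K.NonDegenerate →₀ R :=
  if h : K.IsDegenerate x then 0 else Finsupp.single ⟨n, x, h⟩ 1

lemma linearCombination_mem {S : Type u} {N : Type v} [AddCommGroup N] [Module R N]
    {T : Set S} {p : Submodule R N} {φ : S → N} (hφ : ∀ s ∈ T, φ s ∈ p) {c : S →₀ R}
    (hc : c ∈ Finsupp.supported R R T) : Finsupp.linearCombination R φ c ∈ p := by
  rw [Finsupp.linearCombination_apply]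
  exact Submodule.sum_mem _ fun s hs => Submodule.smul_mem _ _ (hφ s (hc hs))

lemma supported_isInternal (K : SimplicialSet.{u}) : DirectSum.IsInternal
    fun i : ℤ => Finsupp.supported R R {s : K.NonDegenerate | (s.1 : ℤ) = i} := by
  refine isInternal_of_proj _ ?_
    (fun i => Finsupp.linearCombination R fun s : K.NonDegenerate =>
      if (s.1 : ℤ) = i then Finsupp.single s (1 : R) else 0) ?_ ?_
  · rw [eq_top_iff]
    intro c _
    induction c using Finsupp.induction_linear with
    | zero => exact zero_mem _
    | add x y hx hy => exact add_mem (hx trivial) (hy trivial)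
    | single s r =>
      exact Submodule.mem_iSup_of_mem (s.1 : ℤ) (Finsupp.single_mem_supported R r rfl)
  · intro i c hc
    rw [Finsupp.linearCombination_apply]
    conv_rhs => rw [← Finsupp.sum_single c]
    refine Finsupp.sum_congr fun s hs => ?_
    have : (s.1 : ℤ) = i := hc hs
    rw [if_pos this, Finsupp.smul_single, smul_eq_mul, mul_one]
  · intro i j hij c hc
    rw [Finsupp.linearCombination_apply]
    refine Finset.sum_eq_zero fun s hs => ?_
    have : (s.1 : ℤ) = j := hc hs
    dsimp only
    rw [if_neg (by omega), smul_zero]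

/-- The graded module of normalized chains: free on the non-degenerate simplices. -/
@[reducible]
def gradedChains (K : SimplicialSet.{u}) : GradedMod.{u} R where
  carrier := K.NonDegenerate →₀ R
  gr i := Finsupp.supported R R {s : K.NonDegenerate | (s.1 : ℤ) = i}
  isInternal := supported_isInternal R K

lemma cls_mem (K : SimplicialSet.{u}) {n : ℕ} (x : K.X n) {i : ℤ} (hi : (n : ℤ) = i) :
    cls R K x ∈ (K.gradedChains R).gr i := by
  unfold cls
  split_ifs with h
  · exact zero_mem _
  · exact Finsupp.single_mem_supported R 1 hi

/-- The alternating sum of the faces of a simplex. -/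
def boundary (K : SimplicialSet.{u}) : ∀ {n : ℕ}, K.X n → (K.NonDegenerate →₀ R)
  | 0, _ => 0
  | n + 1, x => ∑ i : Fin (n + 2), (-1 : R) ^ (i : ℕ) • cls R K (K.face i x)

/-- The alternating sum of the faces of a degenerate simplex vanishes in the normalized chains. -/
lemma boundary_eq_zero (K : SimplicialSet.{u}) {n : ℕ} (x : K.X n) (hx : K.IsDegenerate x) :
    K.boundary R x = 0 := by
  obtain ⟨m, j, y, h⟩ := hx
  obtain ⟨rfl, h⟩ := Sigma.mk.inj h
  obtain rfl := eq_of_heq h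
  have hne : j.castSucc ≠ j.succ := (Fin.castSucc_lt_succ).ne
  rw [boundary, Finset.sum_eq_add_of_mem _ _ (Finset.mem_univ _) (Finset.mem_univ _) hne]
  · rw [K.face_degen_self, K.face_degen_succ, Fin.val_succ, pow_succ]
    simp
  · rintro i - ⟨h₁, h₂⟩
    have : K.IsDegenerate (K.face i (K.degen j y)) := by
      cases m with
      | zero =>
        exfalso
        fin_cases j
        fin_cases i
        · exact h₁ rfl
        · exact h₂ rfl
      | succ m =>
        rcases lt_or_gt_of_ne h₁ with h | h
        · obtain ⟨j, rfl⟩ := Fin.exists_succ_eq.2 (show j ≠ 0 by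
            rintro rfl; simp at h)
          obtain ⟨i, rfl⟩ := Fin.exists_castSucc_eq.2 (show i ≠ Fin.last _ from
            (h.trans_le (Fin.le_last _)).ne)
          refine ⟨m, j, K.face i y, ?_⟩
          rw [K.face_degen_lt]
          rw [Fin.lt_def] at h
          rw [Fin.le_def]
          simp at h ⊢
          omega
        · obtain ⟨i, rfl⟩ := Fin.exists_succ_eq.2 (show i ≠ 0 by
            rintro rfl; simp at h)
          obtain ⟨j, rfl⟩ := Fin.exists_castSucc_eq.2 (show j ≠ Fin.last _ by
            rintro rfl
            apply h₂
            rw [Fin.succ_last]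
            ext
            have := i.2
            replace h := Fin.lt_def.1 h
            simp at h ⊢
            omega)
          refine ⟨m, j, K.face i y, ?_⟩
          rw [K.face_degen_gt]
          replace h := Fin.lt_def.1 h
          rw [Fin.lt_def]
          have h₂' : (i : ℕ) + 1 ≠ (j : ℕ) + 1 := fun e => h₂ (by ext; simpa using e)
          simp at h ⊢
          omega
    rw [cls, dif_pos this, smul_zero]

lemma boundary_boundary (K : SimplicialSet.{u}) {n : ℕ} (x : K.X (n + 2)) :
    ∑ j : Fin (n + 3), (-1 : R) ^ (j : ℕ) • K.boundary R (K.face j x) = 0 := by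
  simp only [boundary, Finset.smul_sum, smul_smul, ← pow_add]
  rw [← Finset.sum_product']
  let S : Finset (Fin (n + 3) × Fin (n + 2)) := {p | (p.1 : ℕ) ≤ (p.2 : ℕ)}
  rw [Finset.univ_product_univ, ← Finset.sum_add_sum_compl S, ← eq_neg_iff_add_eq_zero,
    ← Finset.sum_neg_distrib]
  refine Finset.sum_bij
    (fun p hp => (p.2.succ, Fin.castLT p.1 (lt_of_le_of_lt (Finset.mem_filter.mp hp).2 p.2.2)))
    ?_ ?_ ?_ ?_
  · rintro ⟨j, i⟩ hp
    simp only [S, Finset.compl_filter, Finset.mem_filter_univ, Fin.val_succ, Fin.val_castLT] at hp ⊢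
    omega
  · rintro ⟨j, i⟩ hp ⟨j', i'⟩ hp' h
    simp only [Prod.mk.injEq, Fin.ext_iff, Fin.val_castLT, Fin.val_succ] at h ⊢
    omega
  · rintro ⟨j, i⟩ hp
    simp only [S, Finset.compl_filter, Finset.mem_filter_univ, not_le] at hp
    obtain ⟨j, rfl⟩ := Fin.exists_succ_eq.2 (show j ≠ 0 by rintro rfl; simp at hp)
    refine ⟨(i.castSucc, j), ?_, ?_⟩
    · simp only [S, Finset.mem_filter_univ, Fin.val_castSucc]
      simp at hp
      omega
    · simp
  · rintro ⟨j, i⟩ hp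
    simp only [S, Finset.mem_filter_univ] at hp
    obtain ⟨j, rfl⟩ := Fin.exists_castSucc_eq.2 (show j ≠ Fin.last _ by
      rintro rfl; have := i.2; simp at hp; omega)
    have h : j ≤ i := by rw [Fin.le_def]; simpa using hp
    simp only [Fin.castLT_castSucc, Fin.val_succ, Fin.val_castSucc]
    rw [K.face_face _ _ _ h, ← neg_smul]
    congr 1
    ring

/-- The differential of the normalized chain complex. -/
def chainsD (K : SimplicialSet.{u}) : (K.NonDegenerate →₀ R) →ₗ[R] (K.NonDegenerate →₀ R) :=
  Finsupp.linearCombination R fun s => K.boundary R s.2.1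

/-- The normalized chain complex `C_*(K)` with coefficients in `R`. -/
@[reducible]
def chains (K : SimplicialSet.{u}) : PreComplex.{u} R where
  toGradedMod := K.gradedChains R
  d := K.chainsD R
  d_deg i c hc := by
    refine linearCombination_mem R (T := {s : K.NonDegenerate | (s.1 : ℤ) = i}) ?_ hc
    rintro ⟨n, x, hx⟩ (h : (n : ℤ) = i)
    cases n with
    | zero => exact zero_mem _
    | succ n =>
      exact Submodule.sum_mem _ fun j _ => Submodule.smul_mem _ _
        (cls_mem R K _ (by push_cast at h; omega))

lemma chainsD_cls (K : SimplicialSet.{u}) {n : ℕ} (x : K.X n) :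
    K.chainsD R (cls R K x) = K.boundary R x := by
  by_cases h : K.IsDegenerate x
  · rw [K.boundary_eq_zero R x h, cls, dif_pos h, map_zero]
  · rw [cls, dif_neg h, chainsD, Finsupp.linearCombination_single, one_smul]

lemma chains_isChainComplex (K : SimplicialSet.{u}) : (K.chains R).IsChainComplex := by
  change K.chainsD R ∘ₗ K.chainsD R = 0
  refine Finsupp.lhom_ext fun s r => ?_
  obtain ⟨n, x, hx⟩ := s
  have : K.chainsD R (Finsupp.single ⟨n, x, hx⟩ r) = r • K.boundary R x := by
    rw [chainsD, Finsupp.linearCombination_single]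
  rw [LinearMap.comp_apply, this, map_smul, LinearMap.zero_apply]
  cases n with
  | zero => rw [boundary, map_zero, smul_zero]
  | succ n =>
    have e : K.chainsD R (K.boundary R x) =
        ∑ j : Fin (n + 2), (-1 : R) ^ (j : ℕ) • K.boundary R (K.face j x) := by
      simp only [boundary, map_sum, map_smul, chainsD_cls]
    rw [e]
    cases n with
    | zero => simp [boundary]
    | succ n => rw [K.boundary_boundary R x, smul_zero]

end SimplicialSet

open SimplicialSet

/-! ### The Eilenberg–Zilber maps and their twisted versions -/

namespace SimplicialSet

/-- `∂_i` on simplices of any dimension (used only for `i ≤ n`, `n ≥ 1`, where `n` is the dimension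
of the simplex). -/
def faceS (K : SimplicialSet.{u}) (i : ℕ) : K.Simplex → K.Simplex
  | ⟨0, x⟩ => ⟨0, x⟩
  | ⟨n + 1, x⟩ => ⟨n, K.face (Fin.ofNat (n + 2) i) x⟩

/-- `η_i` on simplices of any dimension (used only for `i ≤ n`, where `n` is the dimension of the
simplex). -/
def degenS (K : SimplicialSet.{u}) (i : ℕ) (s : K.Simplex) : K.Simplex :=
  ⟨s.1 + 1, K.degen (Fin.ofNat (s.1 + 1) i) s.2⟩

/-- `faces [i₁, …, i_k] x = ∂_{i₁} ⋯ ∂_{i_k} x`. -/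
def faces (K : SimplicialSet.{u}) (l : List ℕ) (s : K.Simplex) : K.Simplex := l.foldr K.faceS s

/-- `degens [i₁, …, i_k] x = η_{i₁} ⋯ η_{i_k} x`. -/
def degens (K : SimplicialSet.{u}) (l : List ℕ) (s : K.Simplex) : K.Simplex := l.foldr K.degenS s

lemma faces_fst (K : SimplicialSet.{u}) (l : List ℕ) (s : K.Simplex) :
    (K.faces l s).1 = s.1 - l.length := by
  induction l with
  | nil => rfl
  | cons i l ih =>
    have h : ∀ t : K.Simplex, (K.faceS i t).1 = t.1 - 1 := by
      rintro ⟨_ | n, x⟩ <;> rfl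
    change (K.faceS i (K.faces l s)).1 = _
    rw [h, ih, List.length_cons]
    omega

lemma degens_fst (K : SimplicialSet.{u}) (l : List ℕ) (s : K.Simplex) :
    (K.degens l s).1 = s.1 + l.length := by
  induction l with
  | nil => rfl
  | cons i l ih =>
    change (K.degens l s).1 + 1 = _
    rw [ih, List.length_cons]
    omega

variable (R)

/-- The class of the simplex `(s, t)` of `X × Y`, for simplices `s`, `t` of equal dimension. -/
def pairCls (X : SimplicialSet.{u}) (Y : SimplicialSet.{v}) (s : X.Simplex) (t : Y.Simplex) :
    (X.prod Y).NonDegenerate →₀ R :=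
  if h : t.1 = s.1 then cls R (X.prod Y) (n := s.1) (s.2, h ▸ t.2) else 0

lemma pairCls_mem (X : SimplicialSet.{u}) (Y : SimplicialSet.{v}) (s : X.Simplex)
    (t : Y.Simplex) {i : ℤ} (hi : (s.1 : ℤ) = i) :
    pairCls R X Y s t ∈ ((X.prod Y).gradedChains R).gr i := by
  unfold pairCls
  split_ifs with h
  · exact cls_mem R _ _ hi
  · exact zero_mem _

end SimplicialSet

/-- The `(p, q)`-shuffles `(α, β)`, encoded by `α ⊆ {0, …, p + q - 1}` with `p` elements; `β` is the
complement of `α`. -/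
def shuffles (p q : ℕ) : Finset (Finset ℕ) := (Finset.range (p + q)).powersetCard p

/-- The list `[α_k, …, α_1]` of the elements of `α = {α_1 < ⋯ < α_k}`. -/
def decreasingList (α : Finset ℕ) : List ℕ := (α.sort (· ≤ ·)).reverse

/-- `sg (α, β) = ∑_{i = 1}^p (α_i - i - 1)`, where `p` is the number of elements of `α`. -/
def shuffleSg (α : Finset ℕ) : ℤ := ∑ a ∈ α, (a : ℤ) - ∑ i ∈ Finset.Icc 1 α.card, ((i : ℤ) + 1)

lemma decreasingList_length (α : Finset ℕ) : (decreasingList α).length = α.card := by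
  simp [decreasingList]

variable (R)

/-- The Alexander–Whitney map on a generator `(x, y)` of dimension `n`:
`∑_{i = 0}^n ∂_{i+1} ⋯ ∂_n x ⊗ ∂_0 ⋯ ∂_{i-1} y`. -/
def alexanderWhitney (X : SimplicialSet.{u}) (Y : SimplicialSet.{v}) {n : ℕ}
    (x : X.X n) (y : Y.X n) : (X.NonDegenerate →₀ R) ⊗[R] (Y.NonDegenerate →₀ R) :=
  ∑ i ∈ Finset.range (n + 1),
    cls R X (X.faces (List.range' (i + 1) (n - i)) ⟨n, x⟩).2 ⊗ₜ[R]
      cls R Y (Y.faces (List.range i) ⟨n, y⟩).2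

/-- The Eilenberg–MacLane map on a generator `x ⊗ y`, with `x`, `y` of dimensions `p`, `q`:
`∑_{(α, β)} (-1)^{sg (α, β)} (η_{β_q} ⋯ η_{β_1} x, η_{α_p} ⋯ η_{α_1} y)`. -/
def eilenbergMacLane (X : SimplicialSet.{u}) (Y : SimplicialSet.{v}) {p q : ℕ}
    (x : X.X p) (y : Y.X q) : (X.prod Y).NonDegenerate →₀ R :=
  ∑ α ∈ shuffles p q, (((shuffleSg α).negOnePow : ℤ) : R) •
    pairCls R X Y (X.degens (decreasingList (Finset.range (p + q) \ α)) ⟨p, x⟩)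
      (Y.degens (decreasingList α) ⟨q, y⟩)

/-- The Shih map on a generator `(x, y)` of dimension `n`: the sum over `0 ≤ q ≤ n - 1`,
`0 ≤ p ≤ n - q - 1` and the `(p + 1, q)`-shuffles `(α, β)` of `(-1)^{m + sg (α, β)}` times
`(η_{β_q + m} ⋯ η_{β_1 + m} η_{m-1} ∂_{n-q+1} ⋯ ∂_n x, η_{α_{p+1} + m} ⋯ η_{α_1 + m} ∂_m ⋯ ∂_{n-q-1} y)`
where `m = n - p - q`. -/
def shih (X : SimplicialSet.{u}) (Y : SimplicialSet.{v}) {n : ℕ}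
    (x : X.X n) (y : Y.X n) : (X.prod Y).NonDegenerate →₀ R :=
  ∑ q ∈ Finset.range n, ∑ p ∈ Finset.range (n - q), ∑ α ∈ shuffles (p + 1) q,
    ((((n : ℤ) - p - q + shuffleSg α).negOnePow : ℤ) : R) •
      pairCls R X Y
        (X.degens ((decreasingList (Finset.range (p + 1 + q) \ α)).map (· + (n - p - q)) ++
            [n - p - q - 1])
          (X.faces (List.range' (n - q + 1) q) ⟨n, x⟩))
        (Y.degens ((decreasingList α).map (· + (n - p - q)))
          (Y.faces (List.range' (n - p - q) p) ⟨n, y⟩))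

/-- The Eilenberg–Zilber maps `C(X × Y) ⇒ C(X) ⊗ C(Y)` (Alexander–Whitney, Eilenberg–MacLane,
Shih). -/
def eilenbergZilber (X : SimplicialSet.{u}) (Y : SimplicialSet.{v}) :
    MapTriple ((X.prod Y).gradedChains R) ((X.gradedChains R).tensor (Y.gradedChains R)) where
  f := Finsupp.linearCombination R fun s => alexanderWhitney R X Y s.2.1.1 s.2.1.2
  g := TensorProduct.lift (Finsupp.linearCombination R fun s =>
    Finsupp.linearCombination R fun t => eilenbergMacLane R X Y s.2.1 t.2.1)
  h := Finsupp.linearCombination R fun s => shih R X Y s.2.1.1 s.2.1.2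
  f_deg k c hc := by
    refine linearCombination_mem R (T := {s : (X.prod Y).NonDegenerate | (s.1 : ℤ) = k}) ?_ hc
    rintro ⟨n, ⟨x, y⟩, hx⟩ (h : (n : ℤ) = k)
    refine Submodule.sum_mem _ fun i hi => ?_
    have hi := Finset.mem_range.mp hi
    refine tmul_mem_tensorGr _ _ (cls_mem R X _ rfl) (cls_mem R Y _ rfl) ?_
    rw [faces_fst, faces_fst, List.length_range', List.length_range]
    dsimp only
    omega
  g_deg k c hc := by
    change c ∈ tensorGr _ _ k at hc
    induction hc using Submodule.span_induction with
    | mem c hc =>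
      obtain ⟨i, j, a, b, hij, ha, hb, rfl⟩ := hc
      have key : ∀ s : X.NonDegenerate, (s.1 : ℤ) = i →
          Finsupp.linearCombination R (fun t : Y.NonDegenerate =>
            eilenbergMacLane R X Y s.2.1 t.2.1) b ∈
              Finsupp.supported R R {s : (X.prod Y).NonDegenerate | (s.1 : ℤ) = k + 0} := ?_
      · let L : (X.NonDegenerate →₀ R) →ₗ[R]
            (Y.NonDegenerate →₀ R) →ₗ[R] ((X.prod Y).NonDegenerate →₀ R) :=
          Finsupp.linearCombination R fun s =>
            Finsupp.linearCombination R fun t => eilenbergMacLane R X Y s.2.1 t.2.1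
        change L a b ∈ Finsupp.supported R R {s : (X.prod Y).NonDegenerate | (s.1 : ℤ) = k + 0}
        have e : L a b = Finsupp.linearCombination R (fun s : X.NonDegenerate =>
            Finsupp.linearCombination R (fun t : Y.NonDegenerate =>
              eilenbergMacLane R X Y s.2.1 t.2.1) b) a := by
          change L.flip b a = _
          congr 1
          refine Finsupp.lhom_ext fun s r => ?_
          simp [L]
        rw [e]
        exact linearCombination_mem R key ha
      rintro ⟨p, x, hx⟩ (hp : (p : ℤ) = i)
      refine linearCombination_mem R (T := {s : Y.NonDegenerate | (s.1 : ℤ) = j}) ?_ hb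
      rintro ⟨q, y, hy⟩ (hq : (q : ℤ) = j)
      refine Submodule.sum_mem _ fun α hα => Submodule.smul_mem _ _ (pairCls_mem R X Y _ _ ?_)
      have hα := Finset.mem_powersetCard.mp hα
      rw [degens_fst, decreasingList_length, Finset.card_sdiff_of_subset hα.1, hα.2,
        Finset.card_range]
      dsimp only
      omega
    | zero => rw [map_zero]; exact zero_mem _
    | add x y _ _ hx hy => rw [map_add]; exact add_mem hx hy
    | smul r x _ hx => rw [map_smul]; exact Submodule.smul_mem _ _ hx
  h_deg k c hc := by
    refine linearCombination_mem R (T := {s : (X.prod Y).NonDegenerate | (s.1 : ℤ) = k}) ?_ hc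
    rintro ⟨n, ⟨x, y⟩, hx⟩ (h : (n : ℤ) = k)
    refine Submodule.sum_mem _ fun q hq => Submodule.sum_mem _ fun p hp =>
      Submodule.sum_mem _ fun α hα => Submodule.smul_mem _ _ (pairCls_mem R X Y _ _ ?_)
    have hα := Finset.mem_powersetCard.mp hα
    have hq : q < n := Finset.mem_range.mp hq
    have h' : n - q + (q + 1) = n + 1 := by omega
    rw [degens_fst, faces_fst, List.length_append, List.length_map, decreasingList_length,
      Finset.card_sdiff_of_subset hα.1, hα.2, Finset.card_range, List.length_range',
      List.length_singleton, Nat.add_sub_cancel_left, h']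
    push_cast
    omega

/-- The perturbation
`δ (g, b) = (-1)^n ((τ b · ∂_n g, ∂_n b) - (∂_n g, ∂_n b))` on generators of dimension `n`. -/
def twistPerturbation (G : SimplicialGroup.{u}) (B : SimplicialSet.{v}) (τ : TwistingOperator B G) :
    ((G.prod B).NonDegenerate →₀ R) →ₗ[R] ((G.prod B).NonDegenerate →₀ R) :=
  Finsupp.linearCombination R fun s => match s with
    | ⟨0, _⟩ => 0
    | ⟨n + 1, x, _⟩ => (-1 : R) ^ (n + 1) •
        (cls R (G.prod B) (n := n)
            (τ.toFun x.2 * G.face (Fin.last (n + 1)) x.1, B.face (Fin.last (n + 1)) x.2) -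
          cls R (G.prod B) (n := n) (G.face (Fin.last (n + 1)) x.1, B.face (Fin.last (n + 1)) x.2))

lemma twistPerturbation_deg (G : SimplicialGroup.{u}) (B : SimplicialSet.{v})
    (τ : TwistingOperator B G) : HasDegree ((G.prod B).gradedChains R)
      ((G.prod B).gradedChains R) (twistPerturbation R G B τ) (-1) := by
  intro k c hc
  refine linearCombination_mem R (T := {s : (G.prod B).NonDegenerate | (s.1 : ℤ) = k}) ?_ hc
  rintro ⟨n, x, hx⟩ (h : (n : ℤ) = k)
  cases n with
  | zero => exact zero_mem _
  | succ n =>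
    exact Submodule.smul_mem _ _ (sub_mem (cls_mem R _ _ (by push_cast at h; omega))
      (cls_mem R _ _ (by push_cast at h; omega)))

/-- The twisted and the untwisted product have the same simplices and the same degeneracies, hence
the same underlying graded module of normalized chains. -/
lemma gradedChains_twistedProduct (G : SimplicialGroup.{u}) (B : SimplicialSet.{v})
    (τ : TwistingOperator B G) :
    (twistedProduct G B τ).gradedChains R = (G.prod B).gradedChains R := rfl

/-- The differential of `C(G ×_τ B)` is the differential of `C(G × B)` plus the perturbation. -/
lemma chainsD_twistedProduct (G : SimplicialGroup.{u}) (B : SimplicialSet.{v})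
    (τ : TwistingOperator B G) : (twistedProduct G B τ).chainsD R =
      (G.prod B).chainsD R + twistPerturbation R G B τ := by
  refine Finsupp.lhom_ext fun s r => ?_
  obtain ⟨n, x, hx⟩ := s
  change (twistedProduct G B τ).chainsD R _ =
    (G.prod B).chainsD R (Finsupp.single ⟨n, x, hx⟩ r) +
      twistPerturbation R G B τ (Finsupp.single ⟨n, x, hx⟩ r)
  rw [chainsD, chainsD, twistPerturbation, Finsupp.linearCombination_single,
    Finsupp.linearCombination_single, Finsupp.linearCombination_single, ← smul_add]
  congr 1
  cases n with
  | zero => exact (add_zero (0 : (G.prod B).NonDegenerate →₀ R)).symm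
  | succ n =>
    have key : ∀ i : Fin (n + 1),
        (twistedProduct G B τ).face i.castSucc x = (G.prod B).face i.castSucc x := by
      intro i
      have hi : i.castSucc ≠ Fin.last (n + 1) := (Fin.castSucc_lt_last _).ne
      exact Prod.ext (if_neg hi) rfl
    have key' : (twistedProduct G B τ).face (Fin.last (n + 1)) x =
        (τ.toFun x.2 * G.face (Fin.last (n + 1)) x.1, B.face (Fin.last (n + 1)) x.2) :=
      Prod.ext (if_pos rfl) rfl
    simp only [boundary]
    rw [Fin.sum_univ_castSucc (fun i : Fin (n + 2) =>
        (-1 : R) ^ (i : ℕ) • cls R (G.prod B) ((G.prod B).face i x)),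
      Fin.sum_univ_castSucc (fun i : Fin (n + 2) => (-1 : R) ^ (i : ℕ) •
        cls R (twistedProduct G B τ) ((twistedProduct G B τ).face i x)), key']
    simp only [key, smul_sub, Fin.val_last]
    have e : ∀ a c d : (G.prod B).NonDegenerate →₀ R, a + d = (a + c) + (d - c) := by
      intros; abel
    exact e _ _ _

/-- The maps of the twisted Eilenberg–Zilber reduction `TEZ : C(G ×_τ B) ⇒ C(G) ⊗_t C(B)`. -/
def twistedEilenbergZilber (G : SimplicialGroup.{u}) (B : SimplicialSet.{v})
    (τ : TwistingOperator B G) :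
    MapTriple ((twistedProduct G B τ).gradedChains R)
      ((G.gradedChains R).tensor (B.gradedChains R)) :=
  (eilenbergZilber R G.toSimplicialSet B).basicPerturbation (twistPerturbation R G B τ)
    (twistPerturbation_deg R G B τ)

/-- The perturbation of `C(G) ⊗ C(B)` induced by `τ` via the Basic Perturbation Lemma. -/
def tensorPerturbation (G : SimplicialGroup.{u}) (B : SimplicialSet.{v})
    (τ : TwistingOperator B G) :
    ((G.NonDegenerate →₀ R) ⊗[R] (B.NonDegenerate →₀ R)) →ₗ[R]
      ((G.NonDegenerate →₀ R) ⊗[R] (B.NonDegenerate →₀ R)) :=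
  (eilenbergZilber R G.toSimplicialSet B).inducedPerturbation (twistPerturbation R G B τ)

lemma tensorPerturbation_deg (G : SimplicialGroup.{u}) (B : SimplicialSet.{v})
    (τ : TwistingOperator B G) :
    HasDegree ((G.gradedChains R).tensor (B.gradedChains R))
      ((G.gradedChains R).tensor (B.gradedChains R)) (tensorPerturbation R G B τ) (-1) :=
  MapTriple.hasDegree_inducedPerturbation _ _ (twistPerturbation_deg R G B τ)

/-- The twisted tensor product `C(G) ⊗_t C(B)`. -/
@[reducible]
def twistedTensor (G : SimplicialGroup.{u}) (B : SimplicialSet.{v}) (τ : TwistingOperator B G) :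
    PreComplex.{max u v} R :=
  ((G.chains R).tensor (B.chains R)).perturb (tensorPerturbation R G B τ)
    (tensorPerturbation_deg R G B τ)

/-! ### The tower `G → E → N`, `M → N → B` with `N = M ×_{τ₁} B`, `E = G ×_{τ₀} N` -/

section Tower

variable (G : SimplicialGroup.{u}) (M : SimplicialGroup.{v}) (B : SimplicialSet.{w})
  (τ₁ : TwistingOperator B M) (τ₀ : TwistingOperator (twistedProduct M B τ₁) G)

/-- The maps of `id ⊗ TEZ₁ : C(G) ⊗ C(M ×_{τ₁} B) ⇒ C(G) ⊗ (C(M) ⊗_{t₁} C(B))`. -/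
def idTensorTEZ : MapTriple
    ((G.gradedChains R).tensor ((twistedProduct M B τ₁).gradedChains R))
    ((G.gradedChains R).tensor ((M.gradedChains R).tensor (B.gradedChains R))) :=
  (MapTriple.trivial (G.gradedChains R)).tensor (twistedEilenbergZilber R M B τ₁)

/-- The perturbation of `C(G) ⊗ (C(M) ⊗_{t₁} C(B))` induced, via the Basic Perturbation Lemma
applied to `id ⊗ TEZ₁`, by the perturbation of `C(G) ⊗ C(M ×_{τ₁} B)` which comes from `τ₀`. -/
def towerPerturbation :
    ((G.gradedChains R).tensor ((M.gradedChains R).tensor (B.gradedChains R))).carrier →ₗ[R]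
      ((G.gradedChains R).tensor ((M.gradedChains R).tensor (B.gradedChains R))).carrier :=
  (idTensorTEZ R G M B τ₁).inducedPerturbation
    (tensorPerturbation R G (twistedProduct M B τ₁) τ₀)

lemma towerPerturbation_deg :
    HasDegree ((G.gradedChains R).tensor ((M.gradedChains R).tensor (B.gradedChains R)))
      ((G.gradedChains R).tensor ((M.gradedChains R).tensor (B.gradedChains R)))
      (towerPerturbation R G M B τ₁ τ₀) (-1) :=
  MapTriple.hasDegree_inducedPerturbation _ _ (tensorPerturbation_deg R G _ τ₀)

/-- `C(G) ⊗_{t₀} (C(M) ⊗_{t₁} C(B))`. -/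
@[reducible]
def towerTensor : PreComplex.{max u v w} R :=
  ((G.chains R).tensor (twistedTensor R M B τ₁)).perturb (towerPerturbation R G M B τ₁ τ₀)
    (towerPerturbation_deg R G M B τ₁ τ₀)

variable {G M B}
variable {R}
variable {CG : PreComplex.{u₁} R} {CM : PreComplex.{v₁} R} {CB : PreComplex.{w₁} R}
  (ρ₀ : Reduction CG (G.chains R)) (ρ₁ : Reduction CM (M.chains R))
  (ρ₂ : Reduction CB (B.chains R))

/-- The perturbed complex `ĈM ⊗_{t₁} ĈB` obtained from the Trivial Perturbation Lemma. -/
@[reducible]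
def hatTensor : PreComplex.{max v₁ w₁} R :=
  (CM.tensor CB).perturb _
    ((ρ₁.tensor ρ₂).hasDegree_pullback _ (tensorPerturbation_deg R M B τ₁))

/-- The reduction `r₁ : ĈM ⊗_{t₁} ĈB ⇒ C(M) ⊗_{t₁} C(B)` obtained from `ρ₁ ⊗ ρ₂` by the Trivial
Perturbation Lemma. -/
def reductionR₁ : Reduction (hatTensor τ₁ ρ₁ ρ₂) (twistedTensor R M B τ₁) :=
  (ρ₁.tensor ρ₂).trivialPerturbation (tensorPerturbation R M B τ₁)
    (tensorPerturbation_deg R M B τ₁)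

/-- The complex `ĈG ⊗_{t₀} (ĈM ⊗_{t₁} ĈB)` obtained from the Trivial Perturbation Lemma. -/
@[reducible]
def hatTowerTensor : PreComplex.{max u₁ v₁ w₁} R :=
  (CG.tensor (hatTensor τ₁ ρ₁ ρ₂)).perturb _
    ((ρ₀.tensor (reductionR₁ τ₁ ρ₁ ρ₂)).hasDegree_pullback _
      (towerPerturbation_deg R G M B τ₁ τ₀))

/-- The reduction `ρ'₁ : ĈG ⊗_{t₀} (ĈM ⊗_{t₁} ĈB) ⇒ C(G) ⊗_{t₀} (C(M) ⊗_{t₁} C(B))` obtained from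
`ρ₀ ⊗ r₁` by the Trivial Perturbation Lemma. -/
def rhoPrimeOne : Reduction (hatTowerTensor τ₁ τ₀ ρ₀ ρ₁ ρ₂) (towerTensor R G M B τ₁ τ₀) :=
  (ρ₀.tensor (reductionR₁ τ₁ ρ₁ ρ₂)).trivialPerturbation (towerPerturbation R G M B τ₁ τ₀)
    (towerPerturbation_deg R G M B τ₁ τ₀)

end Tower

/-! ### The filtration -/

/-- The downset `p(P;2) = T²_P` of `ℤ²`: the points `X` with
`(x₁ + x₂, x₂) ≤ (p₁ + p₂, p₂)` in the lexicographic order. -/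
def downsetT (P : ℤ × ℤ) : LowerSet (ℤ × ℤ) where
  carrier := {X | toLex (X.1 + X.2, X.2) ≤ toLex (P.1 + P.2, P.2)}
  lower' := by
    intro X Y hYX hX
    refine le_trans (α := ℤ ×ₗ ℤ) ?_ hX
    have h₁ := hYX.1
    have h₂ := hYX.2
    rw [Prod.Lex.toLex_le_toLex]
    dsimp only
    omega

variable {R}

/-- `F_{p(P;2)} C_n`: the span of the `a ⊗ (b ⊗ c)` with `a`, `b`, `c` of degrees `i`, `j`, `k` such
that `i + j + k = n` and `(j, k) ∈ p(P;2)`. -/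
def filtration (A : GradedMod.{u} R) (B : GradedMod.{v} R) (C : GradedMod.{w} R) (P : ℤ × ℤ)
    (n : ℤ) : Submodule R (A.tensor (B.tensor C)).carrier :=
  Submodule.span R {t | ∃ (i j k : ℤ) (a : A.carrier) (b : B.carrier) (c : C.carrier),
    i + j + k = n ∧ (j, k) ∈ downsetT P ∧ a ∈ A.gr i ∧ b ∈ B.gr j ∧ c ∈ C.gr k ∧
      t = a ⊗ₜ[R] (b ⊗ₜ[R] c)}

/-- The map `φ₀ ⊗ φ₁ ⊗ φ₂`. -/
def tensorMap₃ {A : GradedMod.{u} R} {B : GradedMod.{v} R} {C : GradedMod.{w} R}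
    {A' : GradedMod.{u₁} R} {B' : GradedMod.{v₁} R} {C' : GradedMod.{w₁} R}
    (φ₀ : A.carrier →ₗ[R] A'.carrier) (φ₁ : B.carrier →ₗ[R] B'.carrier)
    (φ₂ : C.carrier →ₗ[R] C'.carrier) :
    (A.tensor (B.tensor C)).carrier →ₗ[R] (A'.tensor (B'.tensor C')).carrier :=
  TensorProduct.map φ₀ (TensorProduct.map φ₁ φ₂)

end

end SerreTower

end

namespace SerreTower

open GradedMod

/-! The Trivial Perturbation Lemma changes the differentials and leaves the maps alone. It is
applied twice, to `δ₁` and then to the perturbation coming from `τ₀`, so `f`, `g` and `h` are still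
the maps of the plain tensor product of the three reductions, on the same underlying graded groups.
The filtration is also defined by the grading alone. What remains is a count of degrees in the last
two tensor factors.

The maps `f` and `g` are tensor products of maps of degree `0`. They preserve the bidegree `(j, k)`
of the last two factors, hence every piece of the filtration.

Up to Koszul signs, the homotopy is `h₀ ⊗ 1 ⊗ 1 + g₀f₀ ⊗ h₁ ⊗ 1 + g₀f₀ ⊗ g₁f₁ ⊗ h₂`, and its
summands move `(j, k)` by `(0, 0)`, `(1, 0)` and `(0, 1)`. The downset of `P` compares first `j + k`
and then `k`, and passing from `P` to `P + (0, 1)` raises both bounds by one. The first shift stays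
strictly below the new bound on the sum. The other two raise the sum by one, so strict inequalities
stay strict and ties stay ties. In a tie, `k` grows by at most one, which the new second bound
allows. The third shift takes `P` itself to `P + (0, 1)`, so among downsets of this shape this is
the smallest one that the count can give.

`tensorMap₃_mem_filtration` reduces a triple tensor product of homogeneous maps to a statement about
shifts. `tensor_tensor_h` supplies the three summands of the homotopy, and
`tensor_tensor_h_mem_filtration` combines the two. -/

lemma mem_downsetT {P X : ℤ × ℤ} : X ∈ downsetT P ↔
    X.1 + X.2 < P.1 + P.2 ∨ X.1 + X.2 = P.1 + P.2 ∧ X.2 ≤ P.2 := by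
  -- Membership in the lower set unfolds to its carrier predicate. Expanding the lexicographic order
  -- then leaves linear conditions on integers, the form that `omega` needs later on.
  change toLex (X.1 + X.2, X.2) ≤ toLex (P.1 + P.2, P.2) ↔ _
  rw [Prod.Lex.toLex_le_toLex]

/-! ### Filtration shifts of tensor products of homogeneous maps -/

section

variable {R : Type} [CommRing R]
  {A : GradedMod.{u} R} {B : GradedMod.{v} R} {C : GradedMod.{w} R}
  {A' : GradedMod.{u₁} R} {B' : GradedMod.{v₁} R} {C' : GradedMod.{w₁} R}

/-- A tensor product of three homogeneous maps is filtered as soon as the shift of the last two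
degrees carries one downset into the other. -/
lemma tensorMap₃_mem_filtration {φ₀ : A.carrier →ₗ[R] A'.carrier}
    {φ₁ : B.carrier →ₗ[R] B'.carrier} {φ₂ : C.carrier →ₗ[R] C'.carrier} {k₀ k₁ k₂ : ℤ}
    (h₀ : HasDegree A A' φ₀ k₀) (h₁ : HasDegree B B' φ₁ k₁) (h₂ : HasDegree C C' φ₂ k₂)
    {P Q : ℤ × ℤ} {n m : ℤ} (hm : n + (k₀ + k₁ + k₂) = m)
    (hPQ : ∀ j k : ℤ, (j, k) ∈ downsetT P → (j + k₁, k + k₂) ∈ downsetT Q)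
    {x : (A.tensor (B.tensor C)).carrier} (hx : x ∈ filtration A B C P n) :
    tensorMap₃ φ₀ φ₁ φ₂ x ∈ filtration A' B' C' Q m := by
  -- Stated as an inclusion into a preimage submodule, the claim needs checking only on the spanning
  -- set of pure homogeneous tensors, with no decomposition of `x`.
  have hle : filtration A B C P n ≤
      (filtration A' B' C' Q m).comap (tensorMap₃ φ₀ φ₁ φ₂) := by
    refine Submodule.span_le.2 ?_
    rintro _ ⟨i, j, k, a, b, c, hn, hP, ha, hb, hc, rfl⟩
    -- The image of a generator is again a generator, each factor having moved by the degree of its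
    -- own map. The shift `k₀` of the first factor enters only the total degree, since the downset
    -- does not see that factor.
    exact Submodule.subset_span ⟨i + k₀, j + k₁, k + k₂, φ₀ a, φ₁ b, φ₂ c, by omega,
      hPQ j k hP, h₀ i a ha, h₁ j b hb, h₂ k c hc, rfl⟩
  exact hle hx

/-- The homotopy of an iterated tensor product of triples. -/
lemma tensor_tensor_h (ρ₀ : MapTriple A A') (ρ₁ : MapTriple B B') (ρ₂ : MapTriple C C') :
    (ρ₀.tensor (ρ₁.tensor ρ₂)).h =
      tensorMap₃ ρ₀.h LinearMap.id LinearMap.id +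
        (tensorMap₃ ((ρ₀.g ∘ₗ ρ₀.f) ∘ₗ A.sign) ρ₁.h LinearMap.id +
          tensorMap₃ ((ρ₀.g ∘ₗ ρ₀.f) ∘ₗ A.sign) ((ρ₁.g ∘ₗ ρ₁.f) ∘ₗ B.sign) ρ₂.h) := by
  -- The outer homotopy has the identity of the whole inner tensor product as its second factor,
  -- whereas the first summand on the right has `id ⊗ id`; `map_id` identifies the two. Additivity
  -- in the second factor splits the inner homotopy into the last two summands.
  simp only [MapTriple.tensor, tensorMap₃, TensorProduct.map_id, TensorProduct.map_add_right]

/-- This is the factor standing to the left of a homotopy in a tensor product of triples. The Koszul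
sign only rescales each homogeneous component, so the factor contributes no shift. -/
lemma MapTriple.hasDegree_gf_sign (ρ : MapTriple A A') :
    HasDegree A A ((ρ.g ∘ₗ ρ.f) ∘ₗ A.sign) 0 :=
  (ρ.g_deg.comp ρ.f_deg rfl).comp hasDegree_sign rfl

/-- The homotopy of an iterated tensor product of triples shifts the filtration by `(0, 1)`. -/
lemma tensor_tensor_h_mem_filtration (ρ₀ : MapTriple A A') (ρ₁ : MapTriple B B')
    (ρ₂ : MapTriple C C') {P : ℤ × ℤ} {n : ℤ} {x : (A.tensor (B.tensor C)).carrier}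
    (hx : x ∈ filtration A B C P n) :
    (ρ₀.tensor (ρ₁.tensor ρ₂)).h x ∈ filtration A B C (P + (0, 1)) (n + 1) := by
  rw [tensor_tensor_h]
  -- The three summands are handled separately, with degrees `(1, 0, 0)`, `(0, 1, 0)` and `(0, 0,
  -- 1)` on the three factors. Each raises the total degree by one, and each leaves one condition on
  -- downsets.
  refine add_mem
    (tensorMap₃_mem_filtration ρ₀.h_deg hasDegree_id hasDegree_id (by omega) ?_ hx)
    (add_mem
      (tensorMap₃_mem_filtration ρ₀.hasDegree_gf_sign ρ₁.h_deg hasDegree_id (by omega) ?_ hx)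
      (tensorMap₃_mem_filtration ρ₀.hasDegree_gf_sign ρ₁.hasDegree_gf_sign ρ₂.h_deg
        (by omega) ?_ hx)) <;>
  -- Common to all three summands: if `(j, k)` lies in the downset of `P`, then `(j, k)`, `(j + 1,
  -- k)` and `(j, k + 1)` lie in that of `P + (0, 1)`. Both bounds have gone up by one, so each case
  -- is linear arithmetic.
  · intro j k hjk
    simp only [mem_downsetT, Prod.fst_add, Prod.snd_add] at hjk ⊢
    omega

end

end SerreTower

/-! ### The reduction of the tower -/

theorem mainTheorem12
    (G : SerreTower.SimplicialGroup.{u}) (M : SerreTower.SimplicialGroup.{v})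
    (B : SerreTower.SimplicialSet.{w})
    (hM : M.toSimplicialSet.IsOneReduced) (hB : B.IsOneReduced)
    (τ₁ : SerreTower.TwistingOperator B M)
    (τ₀ : SerreTower.TwistingOperator (SerreTower.twistedProduct M B τ₁) G)
    (CG : SerreTower.PreComplex.{u₁} ℤ) (CM : SerreTower.PreComplex.{v₁} ℤ)
    (CB : SerreTower.PreComplex.{w₁} ℤ)
    (hCG : CG.IsChainComplex) (hCM : CM.IsChainComplex) (hCB : CB.IsChainComplex)
    (ρ₀ : SerreTower.Reduction CG (G.chains ℤ)) (ρ₁ : SerreTower.Reduction CM (M.chains ℤ))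
    (ρ₂ : SerreTower.Reduction CB (B.chains ℤ)) :
    ((SerreTower.rhoPrimeOne τ₁ τ₀ ρ₀ ρ₁ ρ₂).f = SerreTower.tensorMap₃ ρ₀.f ρ₁.f ρ₂.f ∧
      (SerreTower.rhoPrimeOne τ₁ τ₀ ρ₀ ρ₁ ρ₂).g = SerreTower.tensorMap₃ ρ₀.g ρ₁.g ρ₂.g) ∧
    (∀ (P : ℤ × ℤ) (n : ℤ),
      ∀ x ∈ SerreTower.filtration CG.toGradedMod CM.toGradedMod CB.toGradedMod P n,
        (SerreTower.rhoPrimeOne τ₁ τ₀ ρ₀ ρ₁ ρ₂).f x ∈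
          SerreTower.filtration (G.gradedChains ℤ) (M.gradedChains ℤ) (B.gradedChains ℤ) P n) ∧
    (∀ (P : ℤ × ℤ) (n : ℤ),
      ∀ x ∈ SerreTower.filtration (G.gradedChains ℤ) (M.gradedChains ℤ) (B.gradedChains ℤ) P n,
        (SerreTower.rhoPrimeOne τ₁ τ₀ ρ₀ ρ₁ ρ₂).g x ∈
          SerreTower.filtration CG.toGradedMod CM.toGradedMod CB.toGradedMod P n) ∧
    (∀ (P : ℤ × ℤ) (n : ℤ),
      ∀ x ∈ SerreTower.filtration CG.toGradedMod CM.toGradedMod CB.toGradedMod P n,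
        (SerreTower.rhoPrimeOne τ₁ τ₀ ρ₀ ρ₁ ρ₂).h x ∈
          SerreTower.filtration CG.toGradedMod CM.toGradedMod CB.toGradedMod
            (P + (0, 1)) (n + 1)) := by
  -- Both formulas hold by definition: each trivial perturbation reuses the triple of the reduction
  -- that it perturbs, so unfolding reaches the iterated tensor product.
  refine ⟨⟨rfl, rfl⟩, fun P n x hx => ?_, fun P n x hx => ?_, fun P n x hx => ?_⟩
  -- All shifts are zero here and for `g`, so the downset condition is trivial with `Q = P`.
  · exact SerreTower.tensorMap₃_mem_filtration ρ₀.f_deg ρ₁.f_deg ρ₂.f_deg (by omega)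
      (fun j k hjk => by simpa using hjk) hx
  · exact SerreTower.tensorMap₃_mem_filtration ρ₀.g_deg ρ₁.g_deg ρ₂.g_deg (by omega)
      (fun j k hjk => by simpa using hjk) hx
  -- The homotopy of the perturbed reduction is, by definition, that of the unperturbed triples, so
  -- the general statement about triples applies directly.
  · exact SerreTower.tensor_tensor_h_mem_filtration ρ₀.toMapTriple ρ₁.toMapTriple
      ρ₂.toMapTriple hx
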